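/- **Definitions.** A *clone* $C$ is a family of sets $(C_n)_{n\in\mathbb N}$ with variables $v_n:\{1,\dots,n\}\to C_n$ and substitutions $s_{m,n}:C_m\times (C_n)^m\to C_n$ such that $s(x;v_n(1),\dots,v_n(n))=x$, $s(v_m(i);y_1,\dots,y_m)=y_i$ and $s(s(x;y_1,\dots,y_l);z)=s(x;s(y_1;z),\dots,s(y_l;z))$ for every tuple $z=(z_1,\dots,z_m)$; clone morphisms are families of maps preserving $v$ and $s$, and $\mathrm{Clone}(D,C)$ denotes the set of clone morphisms $D\to C$. A *Stone-enriched clone* is a clone whose components are Stone spaces (compact, totally separated) and whose operations are continuous; its morphisms are the clone morphisms with continuous components. A clone is *locally finite* if every $C_n$ is finite. For a set $Q$, $\mathrm{End}(Q)$ is the clone with $\mathrm{End}(Q)_n=(Q^n\to Q)$, projections as variables and composition as substitution. A *ranked alphabet* is a finite sequence $\Sigma=[n_1,\dots,n_l]$ of natural numbers. The *free clone* $F\Sigma$ on $\Sigma$ has as $n$-th component the set of finite trees built from $n$ variables and one operation symbol of arity $n_j$ for each $j$; its clone structure is substitution of trees for variables. Clone morphisms $F\Sigma\to C$ correspond bijectively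 to elements of $C_{n_1}\times\dots\times C_{n_l}$. The *profinite completion* $\widehat D$ of a clone $D$ (the value at $D$ of the codensity monad of the inclusion of locally finite clones into clones) is the limit of the locally finite clones $C$ over all morphisms $p:D\to C$. That is, $\widehat D_n$ is the set of families of functions $u_C:\mathrm{Clone}(D,C)\to C_n$, with $C$ ranging over the locally finite clones, such that $\varphi_n(u_C(p))=u_{C'}(\varphi\circ p)$ for all morphisms $\varphi:C\to C'$ of locally finite clones and all $p:D\to C$. Its clone operations are computed pointwise, and its topology is induced by the product $\prod_{p:D\to C}C_n$ of finite discrete spaces. It is a Stone-enriched clone, and $\widehat{F\Sigma}$ is the *free profinite clone* on $\Sigma$. Consider the simply typed $\lambda$-calculus with one base type $o$, arrow types $\Rightarrow$, binary products and a unit type, modulo $\beta\eta$-conversion. For a finite set $Q$, let $[\![-]\!]_Q$ be its interpretation in finite sets with $[\![o]\!]_Q=Q$. A *profinite $\lambda$-term* of type $A$ is a family $\theta=(\theta_Q)_Q$ with $\theta_Q\in[\![A]\!]_Q$, for $Q$ ranging over all finite sets, such that for any two finite sets $Q,Q'$ there is a closed $\lambda$-term $M$ of type $A$ with $\theta_Q=[\![M]\!]_Q$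 and $\theta_{Q'}=[\![M]\!]_{Q'}$. The set $\mathrm{ProTm}(A)$ of these carries the topology induced by the product $\prod_Q[\![A]\!]_Q$ of finite discrete spaces. View $\Sigma$ also as the type $(o^{n_1}\Rightarrow o)\times\dots\times(o^{n_l}\Rightarrow o)$. The Stone-enriched clone $\mathrm{ProChurch}(\Sigma)$ of profinite $\lambda$-terms over $\Sigma$ has components $\mathrm{ProTm}(\Sigma\Rightarrow o^n\Rightarrow o)$, variables $v_n(i)_Q(\sigma)(x)=x_i$ and substitution $$s(\theta;\eta^1,\dots,\eta^m)_Q(\sigma)(x)=\theta_Q(\sigma)\big(\eta^1_Q(\sigma)(x),\dots,\eta^m_Q(\sigma)(x)\big).$$ For $u\in\widehat{F\Sigma}_n$ and a finite set $Q$, let $\mathrm{restrict}(u)_Q:=u_{\mathrm{End}(Q)}$. This is regarded as an element of $[\![\Sigma\Rightarrow o^n\Rightarrow o]\!]_Q$ through the bijections $\mathrm{Clone}(F\Sigma,\mathrm{End}(Q))\cong[\![\Sigma]\!]_Q$ and $[\![o^n]\!]_Q\cong Q^n$. **Theorem (Isomorphism theorem).** For every ranked alphabet $\Sigma$, the assignment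 $u\mapsto(u_{\mathrm{End}(Q)})_Q$ is a well-defined morphism of Stone-enriched clones $$\mathrm{restrict}:\widehat{F\Sigma}\longrightarrow\mathrm{ProChurch}(\Sigma),$$ and it is an isomorphism of Stone-enriched clones. -/

import Mathlib

universe u v w

open CategoryTheory

namespace ProfiniteTree

/-! ### Clones and their morphisms -/

/-- An abstract clone: sets `C_n` with variables `v_n : [n] → C_n` and substitutions
`s_{m,n} : C_m × (C_n)^m → C_n`, subject to the two unit laws and associativity. -/
structure Clone where
  carrier : ℕ → Type u
  var : ∀ n, Fin n → carrier n
  subst : ∀ {m n}, carrier m → (Fin m → carrier n) → carrier n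
  subst_var : ∀ {n} (x : carrier n), subst x (var n) = x
  var_subst : ∀ {m n} (i : Fin m) (y : Fin m → carrier n), subst (var m i) y = y i
  subst_assoc : ∀ {l m n} (x : carrier l) (y : Fin l → carrier m) (z : Fin m → carrier n),
    subst (subst x y) z = subst x (fun i => subst (y i) z)

/-- Clone morphisms. The two clones may live in different universes. -/
@[ext]
structure CloneHom (C : Clone.{u}) (D : Clone.{v}) where
  toFun : ∀ n, C.carrier n → D.carrier n
  map_var : ∀ n (i : Fin n), toFun n (C.var n i) = D.var n i
  map_subst : ∀ {m n} (x : C.carrier m) (y : Fin m → C.carrier n),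
    toFun n (C.subst x y) = D.subst (toFun m x) (fun i => toFun n (y i))

namespace CloneHom

def id (C : Clone.{u}) : CloneHom C C where
  toFun _ x := x
  map_var _ _ := rfl
  map_subst _ _ := rfl

/-- The composite `ψ ∘ φ`. -/
def comp {C : Clone.{u}} {D : Clone.{v}} {E : Clone.{w}} (ψ : CloneHom D E) (φ : CloneHom C D) :
    CloneHom C E where
  toFun n x := ψ.toFun n (φ.toFun n x)
  map_var n i := by rw [φ.map_var, ψ.map_var]
  map_subst x y := by rw [φ.map_subst, ψ.map_subst]

end CloneHom

/-- Locally finite clones: every component is a finite set. -/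
structure FinClone extends Clone.{u} where
  finite : ∀ n, Finite (carrier n)

attribute [instance] FinClone.finite

/-- Finite sets. -/
structure FinSet where
  carrier : Type u
  finite : Finite carrier

attribute [instance] FinSet.finite

/-- The endomorphism clone of a set `Q`: the `n`-th component is the set of functions
`Q^n → Q`, variables are projections and substitution is composition. -/
def Endo (Q : Type u) : Clone.{u} where
  carrier n := (Fin n → Q) → Q
  var _ i := fun x => x i
  subst f g := fun x => f (fun i => g i x)
  subst_var _ := rfl
  var_subst _ _ := rfl
  subst_assoc _ _ _ := rfl

/-- The endomorphism clone of a finite set is locally finite. -/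
def FinEndo (Q : FinSet.{u}) : FinClone.{u} where
  toClone := Endo Q.carrier
  finite n := inferInstanceAs (Finite ((Fin n → Q.carrier) → Q.carrier))

/-! ### Stone-enriched clones -/

/-- A Stone-enriched clone: the components are Stone spaces (compact and totally separated), and
the variables and substitutions are continuous. -/
structure StoneClone extends Clone.{u} where
  [top : ∀ n, TopologicalSpace (carrier n)]
  [compact : ∀ n, CompactSpace (carrier n)]
  [totallySeparated : ∀ n, TotallySeparatedSpace (carrier n)]
  continuous_var : ∀ n, Continuous (var n)
  continuous_subst : ∀ m n,
    Continuous (fun p : carrier m × (Fin m → carrier n) => subst p.1 p.2)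

attribute [instance] StoneClone.top StoneClone.compact StoneClone.totallySeparated

/-- Morphisms of Stone-enriched clones: clone morphisms with continuous components. -/
@[ext]
structure StoneClone.Hom (C D : StoneClone.{u}) extends CloneHom C.toClone D.toClone where
  continuous_toFun : ∀ n, Continuous (toFun n)

/-- The category of Stone-enriched clones. -/
instance : Category.{u} StoneClone.{u} where
  Hom := StoneClone.Hom
  id C := ⟨CloneHom.id C.toClone, fun _ => continuous_id⟩
  comp f g := ⟨CloneHom.comp g.toCloneHom f.toCloneHom,
    fun n => (g.continuous_toFun n).comp (f.continuous_toFun n)⟩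

/-! ### Ranked alphabets and free clones -/

/-- A ranked alphabet is a finite sequence `[n₁, …, n_l]` of natural numbers (the arities). -/
abbrev RankedAlphabet := List ℕ

/-- Trees over the ranked alphabet `S` with leaves labelled by `n` variables. -/
inductive Tree (S : RankedAlphabet) (n : ℕ) : Type
  | var (i : Fin n) : Tree S n
  | node (j : Fin S.length) (ts : Fin (S.get j) → Tree S n) : Tree S n

namespace Tree

/-- Simultaneous substitution of trees for variables. -/
def bind {S : RankedAlphabet} {m n : ℕ} : Tree S m → (Fin m → Tree S n) → Tree S n
  | var i, y => y i
  | node j ts, y => node j (fun k => (ts k).bind y)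

theorem bind_var {S : RankedAlphabet} {n : ℕ} (x : Tree S n) : x.bind var = x := by
  induction x with
  | var i => rfl
  | node j ts ih => simp only [bind, ih]

theorem bind_assoc {S : RankedAlphabet} {l m n : ℕ} (x : Tree S l) (y : Fin l → Tree S m)
    (z : Fin m → Tree S n) : (x.bind y).bind z = x.bind (fun i => (y i).bind z) := by
  induction x with
  | var i => rfl
  | node j ts ih => simp only [bind, ih]

end Tree

/-- The free clone on the ranked alphabet `S`, seen as a signature: trees with variables. -/
def Free (S : RankedAlphabet) : Clone.{0} where
  carrier := Tree S
  var _ := Tree.var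
  subst := Tree.bind
  subst_var := Tree.bind_var
  var_subst _ _ := rfl
  subst_assoc := Tree.bind_assoc

/-- The generators of the free clone. -/
def Free.gen (S : RankedAlphabet) (j : Fin S.length) : (Free S).carrier (S.get j) :=
  Tree.node j Tree.var

/-- Evaluation of trees in a clone `C`, given an element `c j ∈ C_{n_j}` for each letter. -/
def Tree.eval {S : RankedAlphabet} {C : Clone.{u}} (c : ∀ j : Fin S.length, C.carrier (S.get j))
    {n : ℕ} : Tree S n → C.carrier n
  | var i => C.var n i
  | node j ts => C.subst (c j) (fun k => (ts k).eval c)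

/-- The clone morphism out of the free clone that extends a given assignment of the letters. -/
def Free.lift {S : RankedAlphabet} {C : Clone.{u}} (c : ∀ j : Fin S.length, C.carrier (S.get j)) :
    CloneHom (Free S) C where
  toFun _ t := Tree.eval c t
  map_var _ _ := rfl
  map_subst {m n} x y := by
    induction x with
    | var i => exact (C.var_subst i (fun i => Tree.eval c (y i))).symm
    | node j ts ih =>
      change C.subst (c j) (fun k => Tree.eval c ((ts k).bind y)) =
        C.subst (C.subst (c j) fun k => Tree.eval c (ts k)) fun i => Tree.eval c (y i)
      rw [C.subst_assoc]
      congr 1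
      funext k
      exact ih k

/-- The universal property of the free clone: clone morphisms `Free S → C` are in bijection with
families of elements `c j ∈ C_{n_j}`. -/
theorem Free.existsUnique_lift {S : RankedAlphabet} {C : Clone.{u}}
    (c : ∀ j : Fin S.length, C.carrier (S.get j)) :
    ∃! p : CloneHom (Free S) C, ∀ j, p.toFun _ (Free.gen S j) = c j := by
  refine ⟨Free.lift c, fun j => C.subst_var (c j), fun p hp => ?_⟩
  ext n t
  change p.toFun n t = Tree.eval c t
  induction t with
  | var i => exact p.map_var n i
  | node j ts ih =>
    refine (p.map_subst (Free.gen S j) ts).trans ?_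
    rw [hp j]
    exact congrArg (C.subst (c j)) (funext ih)

/-! ### Profinite completion of clones -/

/-- A locally finite clone carries the discrete topology. -/
instance (C : FinClone.{u}) (n : ℕ) : TopologicalSpace (C.carrier n) := ⊥

instance (C : FinClone.{u}) (n : ℕ) : DiscreteTopology (C.carrier n) := ⟨rfl⟩

/-- The `n`-th component of the profinite completion of `D`, i.e. of the limit
of `C` over all morphisms `p : D → C` to locally finite clones: natural
families of functions `u_C : Clone(D, C) → C_n`. -/
@[ext]
structure Completion (D : Clone.{v}) (n : ℕ) where
  app : ∀ C : FinClone.{u}, CloneHom D C.toClone → C.carrier n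
  natural : ∀ (C C' : FinClone.{u}) (φ : CloneHom C.toClone C'.toClone)
    (p : CloneHom D C.toClone), φ.toFun n (app C p) = app C' (φ.comp p)

namespace Completion

/-- The topology induced by the product of the discrete spaces `C_n`. -/
instance (D : Clone.{v}) (n : ℕ) : TopologicalSpace (Completion.{u} D n) :=
  TopologicalSpace.induced Completion.app inferInstance

theorem continuous_app {D : Clone.{v}} {n : ℕ} (C : FinClone.{u}) (p : CloneHom D C.toClone) :
    Continuous fun a : Completion.{u} D n => a.app C p :=
  (continuous_apply p).comp ((continuous_apply C).comp continuous_induced_dom)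

instance (D : Clone.{v}) (n : ℕ) : TotallySeparatedSpace (Completion.{u} D n) := by
  refine totallySeparatedSpace_iff_exists_isClopen.mpr fun a b hab => ?_
  obtain ⟨C, p, h⟩ : ∃ C p, a.app C p ≠ b.app C p := by
    by_contra! h
    exact hab (Completion.ext (funext fun C => funext fun p => h C p))
  exact ⟨_, (isClopen_discrete {a.app C p}).preimage (continuous_app C p), rfl, fun e => h e.symm⟩

instance (D : Clone.{v}) (n : ℕ) : CompactSpace (Completion.{u} D n) := by
  have he : Topology.IsEmbedding (Completion.app (D := D) (n := n)) :=
    ⟨⟨rfl⟩, fun _ _ => Completion.ext⟩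
  refine Topology.IsClosedEmbedding.compactSpace ⟨he, ?_⟩
  have hr : Set.range (Completion.app (D := D) (n := n)) =
      ⋂ (C : FinClone.{u}) (C' : FinClone.{u}) (φ : CloneHom C.toClone C'.toClone)
        (p : CloneHom D C.toClone), {a | φ.toFun n (a C p) = a C' (φ.comp p)} := by
    ext a
    simp only [Set.mem_iInter]
    exact ⟨fun ⟨b, hb⟩ => hb ▸ b.natural, fun h => ⟨⟨a, h⟩, rfl⟩⟩
  rw [hr]
  refine isClosed_iInter fun C => isClosed_iInter fun C' => isClosed_iInter fun φ =>
    isClosed_iInter fun p => isClosed_eq ?_ ?_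
  · exact continuous_of_discreteTopology.comp
      ((continuous_apply p).comp (continuous_apply C))
  · exact (continuous_apply (φ.comp p)).comp (continuous_apply C')

end Completion

/-- The profinite completion of a clone, as a Stone-enriched clone. The operations are computed
componentwise. -/
def ProCompletion (D : Clone.{v}) : StoneClone.{max (u + 1) v} where
  carrier := Completion.{u} D
  var n i := ⟨fun C _ => C.var n i, fun _ _ φ _ => φ.map_var n i⟩
  subst a b := ⟨fun C p => C.subst (a.app C p) (fun i => (b i).app C p), fun C C' φ p => by
    rw [φ.map_subst, a.natural C C' φ p]
    exact congrArg (C'.subst _) (funext fun i => (b i).natural C C' φ p)⟩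
  subst_var a := Completion.ext (funext fun C => funext fun p => C.subst_var (a.app C p))
  var_subst i b := Completion.ext (funext fun C => funext fun p =>
    C.var_subst i fun j => (b j).app C p)
  subst_assoc a b c := Completion.ext (funext fun C => funext fun p => C.subst_assoc _ _ _)
  continuous_var _ := continuous_of_discreteTopology
  continuous_subst m n := by
    refine continuous_induced_rng.mpr (continuous_pi fun C => continuous_pi fun p => ?_)
    have h : Continuous fun q : C.carrier m × (Fin m → C.carrier n) => C.subst q.1 q.2 :=
      continuous_of_discreteTopology
    exact h.comp (((Completion.continuous_app C p).comp continuous_fst).prodMk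
      (continuous_pi fun i => (Completion.continuous_app C p).comp
        ((continuous_apply i).comp continuous_snd)))

/-! ### The simply typed lambda-calculus -/

/-- Simple types over one base type, with products. -/
inductive Ty : Type
  | base : Ty
  | arr (A B : Ty) : Ty
  | prod (A B : Ty) : Ty
  | unit : Ty

/-- The power `A^n`, an `n`-fold product. -/
def Ty.pow (A : Ty) : ℕ → Ty
  | 0 => unit
  | n + 1 => prod A (A.pow n)

/-- The type `(o^{n₁} ⇒ o) × … × (o^{n_l} ⇒ o)` of a ranked alphabet. -/
def RankedAlphabet.ty : RankedAlphabet → Ty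
  | [] => Ty.unit
  | n :: S => Ty.prod (Ty.arr (Ty.base.pow n) Ty.base) (RankedAlphabet.ty S)

/-- The type `Σ ⇒ o^n ⇒ o`. -/
def churchTy (S : RankedAlphabet) (n : ℕ) : Ty :=
  Ty.arr (RankedAlphabet.ty S) (Ty.arr (Ty.base.pow n) Ty.base)

/-- Typed de Bruijn variables: occurrences of a type in a context. -/
inductive Var : List Ty → Ty → Type
  | zero {Γ : List Ty} {A : Ty} : Var (A :: Γ) A
  | succ {Γ : List Ty} {A B : Ty} : Var Γ A → Var (B :: Γ) A

/-- Well-typed preterms, up to the names of the bound variables: `Preterm Γ A` is the type of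
preterms `M` such that `Γ ⊢ M : A`. -/
inductive Preterm : List Ty → Ty → Type
  | var {Γ : List Ty} {A : Ty} : Var Γ A → Preterm Γ A
  | lam {Γ : List Ty} {A B : Ty} : Preterm (A :: Γ) B → Preterm Γ (Ty.arr A B)
  | app {Γ : List Ty} {A B : Ty} : Preterm Γ (Ty.arr A B) → Preterm Γ A → Preterm Γ B
  | pair {Γ : List Ty} {A B : Ty} : Preterm Γ A → Preterm Γ B → Preterm Γ (Ty.prod A B)
  | fst {Γ : List Ty} {A B : Ty} : Preterm Γ (Ty.prod A B) → Preterm Γ A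
  | snd {Γ : List Ty} {A B : Ty} : Preterm Γ (Ty.prod A B) → Preterm Γ B
  | star {Γ : List Ty} : Preterm Γ Ty.unit

/-- Extension of a renaming under a binder. -/
def Var.liftRen {Γ Δ : List Ty} (ρ : ∀ A, Var Γ A → Var Δ A) {B : Ty} :
    ∀ A, Var (B :: Γ) A → Var (B :: Δ) A
  | _, .zero => .zero
  | A, .succ x => .succ (ρ A x)

namespace Preterm

def rename : ∀ {Γ Δ : List Ty} {A : Ty}, (∀ A, Var Γ A → Var Δ A) → Preterm Γ A → Preterm Δ A
  | _, _, _, ρ, var x => var (ρ _ x)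
  | _, _, _, ρ, lam M => lam (M.rename (Var.liftRen ρ))
  | _, _, _, ρ, app M N => app (M.rename ρ) (N.rename ρ)
  | _, _, _, ρ, pair M N => pair (M.rename ρ) (N.rename ρ)
  | _, _, _, ρ, fst M => fst (M.rename ρ)
  | _, _, _, ρ, snd M => snd (M.rename ρ)
  | _, _, _, _, star => star

/-- Weakening by one variable. -/
def weaken {Γ : List Ty} {A B : Ty} (M : Preterm Γ A) : Preterm (B :: Γ) A :=
  M.rename (fun _ => Var.succ)

/-- Extension of a substitution under a binder. -/
def liftSub {Γ Δ : List Ty} (s : ∀ A, Var Γ A → Preterm Δ A) {B : Ty} :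
    ∀ A, Var (B :: Γ) A → Preterm (B :: Δ) A
  | _, .zero => var .zero
  | A, .succ x => (s A x).weaken

/-- Simultaneous capture-avoiding substitution. -/
def subst : ∀ {Γ Δ : List Ty} {A : Ty}, (∀ A, Var Γ A → Preterm Δ A) → Preterm Γ A → Preterm Δ A
  | _, _, _, s, var x => s _ x
  | _, _, _, s, lam M => lam (M.subst (liftSub s))
  | _, _, _, s, app M N => app (M.subst s) (N.subst s)
  | _, _, _, s, pair M N => pair (M.subst s) (N.subst s)
  | _, _, _, s, fst M => fst (M.subst s)
  | _, _, _, s, snd M => snd (M.subst s)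
  | _, _, _, _, star => star

/-- The substitution replacing the last variable by `N`. -/
def single {Γ : List Ty} {B : Ty} (N : Preterm Γ B) : ∀ A, Var (B :: Γ) A → Preterm Γ A
  | _, .zero => N
  | _, .succ x => var x

end Preterm

open Preterm in
/-- The judgment `Γ ⊢ M = N : A` of beta-eta-conversion. -/
inductive BetaEta : ∀ {Γ : List Ty} {A : Ty}, Preterm Γ A → Preterm Γ A → Prop
  | beta {Γ : List Ty} {A B : Ty} (M : Preterm (A :: Γ) B) (N : Preterm Γ A) :
      BetaEta (app (lam M) N) (M.subst (single N))
  | beta_fst {Γ : List Ty} {A B : Ty} (M : Preterm Γ A) (N : Preterm Γ B) :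
      BetaEta (fst (pair M N)) M
  | beta_snd {Γ : List Ty} {A B : Ty} (M : Preterm Γ A) (N : Preterm Γ B) :
      BetaEta (snd (pair M N)) N
  | eta {Γ : List Ty} {A B : Ty} (M : Preterm Γ (Ty.arr A B)) :
      BetaEta M (lam (app M.weaken (var Var.zero)))
  | eta_pair {Γ : List Ty} {A B : Ty} (M : Preterm Γ (Ty.prod A B)) :
      BetaEta M (pair (fst M) (snd M))
  | eta_unit {Γ : List Ty} (M : Preterm Γ Ty.unit) : BetaEta M star
  | congr_lam {Γ : List Ty} {A B : Ty} {M M' : Preterm (A :: Γ) B} :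
      BetaEta M M' → BetaEta (lam M) (lam M')
  | congr_app {Γ : List Ty} {A B : Ty} {M M' : Preterm Γ (Ty.arr A B)} {N N' : Preterm Γ A} :
      BetaEta M M' → BetaEta N N' → BetaEta (app M N) (app M' N')
  | congr_pair {Γ : List Ty} {A B : Ty} {M M' : Preterm Γ A} {N N' : Preterm Γ B} :
      BetaEta M M' → BetaEta N N' → BetaEta (pair M N) (pair M' N')
  | congr_fst {Γ : List Ty} {A B : Ty} {M M' : Preterm Γ (Ty.prod A B)} :
      BetaEta M M' → BetaEta (fst M) (fst M')
  | congr_snd {Γ : List Ty} {A B : Ty} {M M' : Preterm Γ (Ty.prod A B)} :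
      BetaEta M M' → BetaEta (snd M) (snd M')
  | refl {Γ : List Ty} {A : Ty} (M : Preterm Γ A) : BetaEta M M
  | symm {Γ : List Ty} {A : Ty} {M N : Preterm Γ A} : BetaEta M N → BetaEta N M
  | trans {Γ : List Ty} {A : Ty} {M N P : Preterm Γ A} :
      BetaEta M N → BetaEta N P → BetaEta M P

def betaEtaSetoid (A : Ty) : Setoid (Preterm [] A) where
  r := BetaEta
  iseqv := ⟨BetaEta.refl, BetaEta.symm, BetaEta.trans⟩

/-- The set `Tm(A)` of lambda-terms of type `A`: closed preterms modulo beta-eta-conversion. -/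
def Tm (A : Ty) : Type := Quotient (betaEtaSetoid A)

/-! ### Semantics in sets -/

/-- The interpretation of types, the base type being interpreted by `Q`. -/
def Ty.sem (Q : Type u) : Ty → Type u
  | base => Q
  | arr A B => A.sem Q → B.sem Q
  | prod A B => A.sem Q × B.sem Q
  | unit => PUnit

instance Ty.finite_sem (Q : Type u) [Finite Q] : ∀ A : Ty, Finite (A.sem Q)
  | base => inferInstanceAs (Finite Q)
  | arr A B =>
    have := Ty.finite_sem Q A
    have := Ty.finite_sem Q B
    inferInstanceAs (Finite (A.sem Q → B.sem Q))
  | prod A B =>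
    have := Ty.finite_sem Q A
    have := Ty.finite_sem Q B
    inferInstanceAs (Finite (A.sem Q × B.sem Q))
  | unit => inferInstanceAs (Finite PUnit)

/-- The interpretation of a context: valuations of its variables. -/
def Env (Q : Type u) (Γ : List Ty) : Type u := ∀ A, Var Γ A → A.sem Q

def Env.nil {Q : Type u} : Env Q [] := fun _ x => nomatch x

def Env.cons {Q : Type u} {Γ : List Ty} {B : Ty} (b : B.sem Q) (e : Env Q Γ) : Env Q (B :: Γ)
  | _, .zero => b
  | A, .succ x => e A x

namespace Preterm

/-- The interpretation of a preterm `Γ ⊢ M : A` as a function from valuations of `Γ` to the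
interpretation of `A`. -/
def sem (Q : Type u) : ∀ {Γ : List Ty} {A : Ty}, Preterm Γ A → Env Q Γ → A.sem Q
  | _, _, var x, e => e _ x
  | _, _, lam M, e => fun b => M.sem Q (Env.cons b e)
  | _, _, app M N, e => (show _ → _ from M.sem Q e) (N.sem Q e)
  | _, _, pair M N, e => (M.sem Q e, N.sem Q e)
  | _, _, fst M, e => Prod.fst (M.sem Q e)
  | _, _, snd M, e => Prod.snd (M.sem Q e)
  | _, _, star, _ => PUnit.unit

theorem sem_rename (Q : Type u) {Γ Δ : List Ty} {A : Ty} (M : Preterm Γ A)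
    (ρ : ∀ A, Var Γ A → Var Δ A) (e : Env Q Δ) :
    (M.rename ρ).sem Q e = M.sem Q (fun A x => e A (ρ A x)) := by
  induction M generalizing Δ with
  | var x => rfl
  | lam M ih =>
    funext b
    refine (ih _ _).trans (congrArg _ ?_)
    funext A x
    cases x <;> rfl
  | app M N ihM ihN => simp only [rename, sem, ihM, ihN]
  | pair M N ihM ihN => exact Prod.ext (ihM _ _) (ihN _ _)
  | fst M ih => simp only [rename, sem, ih]
  | snd M ih => simp only [rename, sem, ih]
  | star => rfl

theorem sem_subst (Q : Type u) {Γ Δ : List Ty} {A : Ty} (M : Preterm Γ A)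
    (s : ∀ A, Var Γ A → Preterm Δ A) (e : Env Q Δ) :
    (M.subst s).sem Q e = M.sem Q (fun A x => (s A x).sem Q e) := by
  induction M generalizing Δ with
  | var x => rfl
  | lam M ih =>
    funext b
    refine (ih _ _).trans (congrArg _ ?_)
    funext A x
    cases x with
    | zero => rfl
    | succ x => exact sem_rename Q _ _ _
  | app M N ihM ihN => simp only [subst, sem, ihM, ihN]
  | pair M N ihM ihN => exact Prod.ext (ihM _ _) (ihN _ _)
  | fst M ih => simp only [subst, sem, ih]
  | snd M ih => simp only [subst, sem, ih]
  | star => rfl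

end Preterm

/-- The interpretation is invariant under beta-eta-conversion. -/
theorem BetaEta.sem_eq (Q : Type u) {Γ : List Ty} {A : Ty} {M N : Preterm Γ A}
    (h : BetaEta M N) (e : Env Q Γ) : M.sem Q e = N.sem Q e := by
  induction h with
  | beta M N =>
    refine Eq.trans (congrArg (M.sem Q) ?_) (Preterm.sem_subst Q M _ e).symm
    funext A x
    cases x <;> rfl
  | beta_fst M N => rfl
  | beta_snd M N => rfl
  | eta M =>
    funext b
    exact congrFun (Preterm.sem_rename Q M (fun _ => Var.succ) (Env.cons b e)).symm b
  | eta_pair M => rfl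
  | eta_unit M => rfl
  | congr_lam _ ih => exact funext fun b => ih _
  | congr_app _ _ ih ih' => simp only [Preterm.sem, ih, ih']
  | congr_pair _ _ ih ih' => exact Prod.ext (ih e) (ih' e)
  | congr_fst _ ih => simp only [Preterm.sem, ih]
  | congr_snd _ ih => simp only [Preterm.sem, ih]
  | refl M => rfl
  | symm _ ih => exact (ih e).symm
  | trans _ _ ih ih' => exact (ih e).trans (ih' e)

/-- The interpretation of lambda-terms. -/
def Tm.sem (Q : Type u) {A : Ty} (M : Tm A) : A.sem Q :=
  Quotient.lift (s := betaEtaSetoid A) (fun M : Preterm [] A => M.sem Q Env.nil)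
    (fun _ _ h => BetaEta.sem_eq Q h Env.nil) M

/-! ### Tuples -/

/-- The components of an element of the interpretation of `A^n`. -/
def proj {Q : Type u} {A : Ty} : ∀ {n : ℕ}, (A.pow n).sem Q → Fin n → A.sem Q
  | 0, _ => Fin.elim0
  | _ + 1, x => Fin.cons (Prod.fst x) (proj (Prod.snd x))

/-- The element of the interpretation of `A^n` with given components. -/
def tuple {Q : Type u} {A : Ty} : ∀ {n : ℕ}, (Fin n → A.sem Q) → (A.pow n).sem Q
  | 0, _ => PUnit.unit
  | _ + 1, f => (f 0, tuple (fun i => f i.succ))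

theorem proj_tuple {Q : Type u} {A : Ty} {n : ℕ} (f : Fin n → A.sem Q) : proj (tuple f) = f := by
  induction n with
  | zero => exact funext fun i => i.elim0
  | succ n ih =>
    funext i
    refine Fin.cases rfl (fun i => ?_) i
    exact congrFun (ih fun i => f i.succ) i

theorem tuple_proj {Q : Type u} {A : Ty} {n : ℕ} (x : (A.pow n).sem Q) : tuple (proj x) = x := by
  induction n with
  | zero => rfl
  | succ n ih => exact Prod.ext rfl (ih x.2)

namespace Preterm

def projTm {Γ : List Ty} {A : Ty} : ∀ {n : ℕ}, Fin n → Preterm Γ (A.pow n) → Preterm Γ A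
  | _ + 1, ⟨0, _⟩, M => fst M
  | _ + 1, ⟨i + 1, h⟩, M => projTm ⟨i, Nat.lt_of_succ_lt_succ h⟩ (snd M)

def tupleTm {Γ : List Ty} {A : Ty} : ∀ {n : ℕ}, (Fin n → Preterm Γ A) → Preterm Γ (A.pow n)
  | 0, _ => star
  | _ + 1, f => pair (f 0) (tupleTm fun i => f i.succ)

theorem sem_projTm (Q : Type u) {Γ : List Ty} {A : Ty} {n : ℕ} (i : Fin n)
    (M : Preterm Γ (A.pow n)) (e : Env Q Γ) : (projTm i M).sem Q e = proj (M.sem Q e) i := by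
  induction n with
  | zero => exact i.elim0
  | succ n ih =>
    obtain ⟨_ | i, h⟩ := i
    · rfl
    · exact ih ⟨i, Nat.lt_of_succ_lt_succ h⟩ (snd M)

theorem sem_tupleTm (Q : Type u) {Γ : List Ty} {A : Ty} {n : ℕ} (f : Fin n → Preterm Γ A)
    (e : Env Q Γ) : (tupleTm f).sem Q e = tuple (fun i => (f i).sem Q e) := by
  induction n with
  | zero => rfl
  | succ n ih => exact Prod.ext rfl (ih fun i => f i.succ)

end Preterm

/-! ### Profinite lambda-terms -/

/-- Profinite lambda-terms of type `A`: families `θ_Q`, for `Q` a finite set, such that any two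
components are interpretations of a common lambda-term. -/
@[ext]
structure ProTm (A : Ty) : Type (u + 1) where
  app : ∀ Q : FinSet.{u}, A.sem Q.carrier
  definable : ∀ Q Q' : FinSet.{u}, ∃ M : Tm A, app Q = M.sem Q.carrier ∧ app Q' = M.sem Q'.carrier

instance (Q : FinSet.{u}) (A : Ty) : TopologicalSpace (A.sem Q.carrier) := ⊥

instance (Q : FinSet.{u}) (A : Ty) : DiscreteTopology (A.sem Q.carrier) := ⟨rfl⟩

namespace ProTm

/-- The topology induced by the product of the finite discrete interpretations of `A`. -/
instance (A : Ty) : TopologicalSpace (ProTm.{u} A) :=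
  TopologicalSpace.induced ProTm.app inferInstance

theorem continuous_app {A : Ty} (Q : FinSet.{u}) : Continuous fun θ : ProTm.{u} A => θ.app Q :=
  (continuous_apply Q).comp continuous_induced_dom

instance (A : Ty) : TotallySeparatedSpace (ProTm.{u} A) := by
  refine totallySeparatedSpace_iff_exists_isClopen.mpr fun a b hab => ?_
  obtain ⟨Q, h⟩ : ∃ Q, a.app Q ≠ b.app Q := by
    by_contra! h
    exact hab (ProTm.ext (funext h))
  exact ⟨_, (isClopen_discrete {a.app Q}).preimage (continuous_app Q), rfl, fun e => h e.symm⟩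

instance (A : Ty) : CompactSpace (ProTm.{u} A) := by
  have he : Topology.IsEmbedding (ProTm.app (A := A)) := ⟨⟨rfl⟩, fun _ _ => ProTm.ext⟩
  refine Topology.IsClosedEmbedding.compactSpace ⟨he, ?_⟩
  have hr : Set.range (ProTm.app (A := A)) = ⋂ (Q : FinSet.{u}) (Q' : FinSet.{u}),
      (fun θ => (θ Q, θ Q')) ⁻¹' {x : A.sem Q.carrier × A.sem Q'.carrier |
        ∃ M : Tm A, x.1 = M.sem Q.carrier ∧ x.2 = M.sem Q'.carrier} := by
    ext a
    simp only [Set.mem_iInter]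
    exact ⟨fun ⟨b, hb⟩ => hb ▸ b.definable, fun h => ⟨⟨a, h⟩, rfl⟩⟩
  rw [hr]
  exact isClosed_iInter fun Q => isClosed_iInter fun Q' => (isClosed_discrete _).preimage
      ((continuous_apply Q).prodMk (continuous_apply Q'))

/-- The `i`-th variable, `λσ. λx. x.i`. -/
def var (S : RankedAlphabet) (n : ℕ) (i : Fin n) : ProTm.{u} (churchTy S n) where
  app _ := fun _ x => proj (A := Ty.base) x i
  definable Q Q' := by
    let M : Preterm [] (churchTy S n) := .lam (.lam (.projTm i (.var .zero)))
    have h : ∀ Q : Type u, M.sem Q Env.nil = fun _ x => proj (A := Ty.base) x i := fun Q =>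
      funext fun σ => funext fun x => Preterm.sem_projTm Q i _ _
    exact ⟨Quotient.mk _ M, (h _).symm, (h _).symm⟩

/-- The substitution `λσ. λx. θ σ (η₁ σ x, …, η_m σ x)` on the level of interpretations. -/
def semSubst (Q : Type u) (S : RankedAlphabet) {m n : ℕ} (f : (churchTy S m).sem Q)
    (g : Fin m → (churchTy S n).sem Q) : (churchTy S n).sem Q :=
  fun σ x => f σ (tuple (A := Ty.base) fun i => g i σ x)

/-- The substitution `λσ. λx. θ σ (η₁ σ x, …, η_m σ x)`, computed componentwise. -/
def subst (S : RankedAlphabet) {m n : ℕ} (θ : ProTm.{u} (churchTy S m))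
    (η : Fin m → ProTm.{u} (churchTy S n)) : ProTm.{u} (churchTy S n) where
  app Q := semSubst Q.carrier S (θ.app Q) fun i => (η i).app Q
  definable Q Q' := by
    obtain ⟨M, hM, hM'⟩ := θ.definable Q Q'
    choose N hN hN' using fun i => (η i).definable Q Q'
    obtain ⟨M, rfl⟩ := Quotient.exists_rep M
    choose N₀ hN₀ using fun i => Quotient.exists_rep (N i)
    obtain rfl : (fun i => Quotient.mk (betaEtaSetoid (churchTy S n)) (N₀ i)) = N := funext hN₀
    let ρ : ∀ A, Var [] A → Var [Ty.base.pow n, RankedAlphabet.ty S] A := fun _ x => nomatch x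
    let P : Preterm [] (churchTy S n) := .lam (.lam
      (.app (.app (M.rename ρ) (.var (.succ .zero))) (.tupleTm fun i =>
        .app (.app ((N₀ i).rename ρ) (.var (.succ .zero))) (.var .zero))))
    have e : ∀ (Q : Type u) {A : Ty} (L : Preterm [] A) (e : Env Q _),
        (L.rename ρ).sem Q e = L.sem Q Env.nil := fun Q A L e =>
      (Preterm.sem_rename Q L ρ e).trans (congrArg _ (funext fun _ => funext fun x => nomatch x))
    have h : ∀ Q : Type u, P.sem Q Env.nil =
        semSubst Q S (M.sem Q Env.nil) fun i => (N₀ i).sem Q Env.nil := by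
      intro Q
      funext σ x
      have h₁ := e Q M (Env.cons x (Env.cons σ Env.nil))
      have h₂ := fun i => e Q (N₀ i) (Env.cons x (Env.cons σ Env.nil))
      refine (congrArg _ (Preterm.sem_tupleTm Q _ _)).trans ?_
      refine (congrFun (congrFun h₁ σ) _).trans ?_
      exact congrArg (M.sem Q Env.nil σ) (congrArg tuple
        (funext fun i => congrFun (congrFun (h₂ i) σ) x))
    refine ⟨Quotient.mk _ P, ?_, ?_⟩
    · exact (congrArg₂ (semSubst Q.carrier S) hM (funext hN)).trans (h _).symm
    · exact (congrArg₂ (semSubst Q'.carrier S) hM' (funext hN')).trans (h _).symm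

end ProTm

/-- The Stone-enriched clone of profinite lambda-terms over `S`, whose `n`-th component is
`ProTm(Σ ⇒ o^n ⇒ o)`. This is the endomorphism clone of `o` in the Kleisli category of the
reader monad `Σ ⇒ (-)` on profinite lambda-terms: the alphabet argument `σ` is shared, and
composition is computed componentwise. -/
def ProChurch (S : RankedAlphabet) : StoneClone.{u + 1} where
  carrier n := ProTm.{u} (churchTy S n)
  var := ProTm.var S
  subst := ProTm.subst S
  subst_var θ := ProTm.ext (funext fun Q => funext fun σ => funext fun x =>
    congrArg (θ.app Q σ) (tuple_proj (A := Ty.base) x))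
  var_subst i η := ProTm.ext (funext fun Q => funext fun σ => funext fun x =>
    congrFun (proj_tuple (A := Ty.base) fun i => (η i).app Q σ x) i)
  subst_assoc _ _ _ := rfl
  continuous_var _ := continuous_of_discreteTopology
  continuous_subst m n := by
    refine continuous_induced_rng.mpr (continuous_pi fun Q => ?_)
    have h : Continuous fun q : (churchTy S m).sem Q.carrier ×
        (Fin m → (churchTy S n).sem Q.carrier) => ProTm.semSubst Q.carrier S q.1 q.2 :=
      continuous_of_discreteTopology
    exact h.comp (((ProTm.continuous_app Q).comp continuous_fst).prodMk
      (continuous_pi fun i => (ProTm.continuous_app Q).comp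
        ((continuous_apply i).comp continuous_snd)))

/-! ### The restriction of profinite trees -/

/-- The operations on `Q` given by an element of the interpretation of the type of `S`. -/
def letters {Q : Type u} : ∀ {S : RankedAlphabet}, (RankedAlphabet.ty S).sem Q →
    ∀ j : Fin S.length, (Endo Q).carrier (S.get j)
  | [], _ => fun j => j.elim0
  | _ :: S, σ => Fin.cases (fun x => (Prod.fst σ) (tuple (A := Ty.base) x))
      (letters (S := S) (Prod.snd σ))

/-- The restriction of a profinite tree `a` to the clones `Endo Q`, for `Q` a finite set. The
function `a_{Endo Q} : Clone(Free Σ, Endo Q) → (Q^n → Q)` is seen as an element of the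
interpretation of `Σ ⇒ o^n ⇒ o` through the bijections between clone morphisms `Free Σ → Endo Q`
and elements of the interpretation of `Σ`, and between the interpretation of `o^n` and `Q^n`. -/
def restrict {S : RankedAlphabet} {n : ℕ} (a : Completion.{u} (Free S) n) (Q : FinSet.{u}) :
    (churchTy S n).sem Q.carrier :=
  fun σ x => a.app (FinEndo Q) (Free.lift (letters σ)) (proj (A := Ty.base) x)

end ProfiniteTree

/-!
The inverse of `restrict` exists because profinite lambda-terms are parametric. By definition, any
two components `θ_Q` and `θ_Q'` of a profinite lambda-term `θ` are interpretations of one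
lambda-term, so the fundamental lemma of logical relations (`Preterm.rel_sem`) applies to the pair
`(θ_Q, θ_Q')`, for every relation between `Q` and `Q'`. For the graph of a homomorphism
`f : Q → Q'` of algebras over the alphabet this says that `f` commutes with the operations that
`θ` defines on `Q` and `Q'` (`ProTm.map_app`). No normalization of lambda-terms is needed.

A clone `C` acts on each of its components by substitution, which is a morphism
`C → End(C_n)` (`Clone.act`), and `x ∈ C_n` is recovered from its action by evaluation at the
variables. Hence a profinite tree is determined by its values at endomorphism clones of finite sets,
and a profinite lambda-term `θ` is extended to all locally finite clones by
`u_C(p) = θ_{C_n}(act ∘ p)(v_n)` (`ProTm.extend`). Naturality in `C` holds since a clone morphism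
`φ : C → C'` gives a homomorphism `φ_n : C_n → C'_n`. The restriction of `u` is `θ` since
evaluation at a point `x ∈ Q^n` is a homomorphism `End(Q)_n → Q`.

In the other direction, the restriction of a profinite tree `a` is definable because finitely many
values of `a` are always realized by one tree (`Completion.exists_forall_app_eq`), as is seen
in the image of the free clone in the product of the clones concerned, and because trees
are lambda-terms (`Tree.toTm`). Finally, a continuous bijection between compact Hausdorff spaces
is a homeomorphism.
-/

namespace ProfiniteTree

/-! ### Products, images and actions of clones -/

/-- The product of a family of clones. -/
def Clone.pi {I : Type u} (C : I → Clone.{u}) : Clone.{u} where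
  carrier n := ∀ i, (C i).carrier n
  var n k := fun i => (C i).var n k
  subst x y := fun i => (C i).subst (x i) fun k => y k i
  subst_var x := funext fun i => (C i).subst_var (x i)
  var_subst k y := funext fun i => (C i).var_subst k fun k => y k i
  subst_assoc _ _ _ := funext fun i => (C i).subst_assoc _ _ _

/-- The image of a clone morphism. -/
def CloneHom.range {D : Clone.{v}} {C : Clone.{u}} (p : CloneHom D C) : Clone.{u} where
  carrier n := Set.range (p.toFun n)
  var n i := ⟨C.var n i, D.var n i, p.map_var n i⟩
  subst x y := ⟨C.subst x.1 fun i => (y i).1, by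
    obtain ⟨s, hs⟩ := x.2
    choose t ht using fun i => (y i).2
    exact ⟨D.subst s t, (p.map_subst s t).trans (congrArg₂ _ hs (funext ht))⟩⟩
  subst_var x := Subtype.ext (C.subst_var x.1)
  var_subst i y := Subtype.ext (C.var_subst i fun i => (y i).1)
  subst_assoc _ _ _ := Subtype.ext (C.subst_assoc _ _ _)

/-- The action of a clone on its `k`-th component by substitution. -/
def Clone.act (C : Clone.{u}) (k : ℕ) : CloneHom C (Endo (C.carrier k)) where
  toFun _ x := fun y => C.subst x y
  map_var _ i := funext fun y => C.var_subst i y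
  map_subst x y := funext fun z => C.subst_assoc x y z

/-- Finitely many values of an element of the profinite completion of `D` are realized by one
element of `D`. -/
theorem Completion.exists_forall_app_eq {D : Clone.{v}} {n : ℕ} (a : Completion.{u} D n)
    {I : Type u} [Finite I] (C : I → FinClone.{u}) (p : ∀ i, CloneHom D (C i).toClone) :
    ∃ t : D.carrier n, ∀ i, a.app (C i) (p i) = (p i).toFun n t := by
  let P : CloneHom D (Clone.pi fun i => (C i).toClone) :=
    { toFun := fun n t i => (p i).toFun n t
      map_var := fun n k => funext fun i => (p i).map_var n k
      map_subst := fun x y => funext fun i => (p i).map_subst x y }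
  let E : FinClone.{u} :=
    { toClone := P.range
      finite := fun n =>
        have : Finite ((Clone.pi fun i => (C i).toClone).carrier n) :=
          inferInstanceAs (Finite (∀ i, (C i).carrier n))
        inferInstanceAs (Finite (Set.range (P.toFun n))) }
  let q : CloneHom D E.toClone :=
    { toFun := fun n t => ⟨P.toFun n t, t, rfl⟩
      map_var := fun n k => Subtype.ext (P.map_var n k)
      map_subst := fun x y => Subtype.ext (P.map_subst x y) }
  let π : ∀ i, CloneHom E.toClone (C i).toClone := fun i =>
    { toFun := fun n x => x.1 i
      map_var := fun _ _ => rfl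
      map_subst := fun _ _ => rfl }
  obtain ⟨t, ht⟩ := (a.app E q).2
  exact ⟨t, fun i => (a.natural E (C i) (π i) q).symm.trans (congrFun ht i).symm⟩

/-! ### Algebras over a ranked alphabet as interpretations of its type -/

/-- The element of the interpretation of the type of `S` given by a family of operations on `Q`;
the inverse of `letters`. -/
def ofLetters {Q : Type u} : ∀ {S : RankedAlphabet},
    (∀ j : Fin S.length, (Endo Q).carrier (S.get j)) → (RankedAlphabet.ty S).sem Q
  | [], _ => PUnit.unit
  | _ :: S, c => (fun x => c 0 (proj (A := Ty.base) x), ofLetters (S := S) fun j => c j.succ)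

theorem letters_ofLetters {Q : Type u} {S : RankedAlphabet}
    (c : ∀ j : Fin S.length, (Endo Q).carrier (S.get j)) : letters (ofLetters c) = c := by
  induction S with
  | nil => exact funext fun j => j.elim0
  | cons n S ih =>
    funext j
    refine Fin.cases ?_ (fun j => ?_) j
    · exact funext fun x => congrArg (c 0) (proj_tuple (A := Ty.base) x)
    · exact congrFun (ih fun j => c j.succ) j

theorem ofLetters_letters {Q : Type u} {S : RankedAlphabet} (σ : (RankedAlphabet.ty S).sem Q) :
    ofLetters (letters σ) = σ := by
  induction S with
  | nil => rfl
  | cons n S ih =>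
    exact Prod.ext (funext fun x => congrArg (Prod.fst σ) (tuple_proj (A := Ty.base) x)) (ih σ.2)

/-! ### Trees as lambda-terms -/

/-- The projection of a term of the type of `S` to the factor of a letter. -/
def letterTm {Γ : List Ty} : ∀ {S : RankedAlphabet}, Preterm Γ (RankedAlphabet.ty S) →
    ∀ j : Fin S.length, Preterm Γ (Ty.arr (Ty.base.pow (S.get j)) Ty.base)
  | [], _ => fun j => j.elim0
  | _ :: S, M => Fin.cases (.fst M) (letterTm (S := S) (.snd M))

theorem sem_letterTm (Q : Type u) {Γ : List Ty} {S : RankedAlphabet}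
    (M : Preterm Γ (RankedAlphabet.ty S)) (j : Fin S.length) (e : Env Q Γ)
    (x : Fin (S.get j) → Q) :
    (show _ → _ from (letterTm M j).sem Q e) (tuple (A := Ty.base) x) =
      letters (M.sem Q e) j x := by
  induction S with
  | nil => exact j.elim0
  | cons n S ih =>
    induction j using Fin.cases with
    | zero => rfl
    | succ j => exact ih (.snd M) j x

/-- The open lambda-term of a tree, in the context `σ : Σ, x : o^n`. -/
def Tree.toTm {S : RankedAlphabet} {n : ℕ} :
    Tree S n → Preterm [Ty.base.pow n, RankedAlphabet.ty S] Ty.base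
  | var i => .projTm i (.var .zero)
  | node j ts => .app (letterTm (.var (.succ .zero)) j) (.tupleTm fun k => (ts k).toTm)

theorem Tree.sem_toTm (Q : Type u) {S : RankedAlphabet} {n : ℕ} (t : Tree S n)
    (σ : (RankedAlphabet.ty S).sem Q) (x : (Ty.base.pow n).sem Q) :
    t.toTm.sem Q (Env.cons x (Env.cons σ Env.nil)) =
      t.eval (C := Endo Q) (letters σ) (proj (A := Ty.base) x) := by
  induction t with
  | var i => exact Preterm.sem_projTm Q i _ _
  | node j ts ih =>
    refine (congrArg _ ((Preterm.sem_tupleTm Q _ _).trans (congrArg tuple (funext ih)))).trans ?_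
    exact sem_letterTm Q _ j _ _

/-- The profinite lambda-term given by the restriction of a profinite tree. For definability, the
values of the tree at all the algebra structures on `Q` and `Q'` are realized by one tree. -/
def Completion.toProTm {S : RankedAlphabet} {n : ℕ} (a : Completion.{u} (Free S) n) :
    ProTm.{u} (churchTy S n) where
  app := restrict a
  definable Q Q' := by
    obtain ⟨t, ht⟩ := a.exists_forall_app_eq
      (I := (RankedAlphabet.ty S).sem Q.carrier ⊕ (RankedAlphabet.ty S).sem Q'.carrier)
      (Sum.elim (fun _ => FinEndo Q) fun _ => FinEndo Q')
      (fun i => match i with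
        | .inl σ => Free.lift (C := Endo Q.carrier) (letters σ)
        | .inr σ => Free.lift (C := Endo Q'.carrier) (letters σ))
    refine ⟨Quotient.mk _ (.lam (.lam t.toTm)), ?_, ?_⟩
    · funext σ x
      exact (congrFun (ht (.inl σ)) _).trans (t.sem_toTm _ σ x).symm
    · funext σ x
      exact (congrFun (ht (.inr σ)) _).trans (t.sem_toTm _ σ x).symm

/-! ### Logical relations -/

/-- The logical relation on the interpretations of types that is generated by a relation on the
base type. -/
def Ty.rel {Q : Type u} {Q' : Type v} (R : Q → Q' → Prop) : ∀ A : Ty, A.sem Q → A.sem Q' → Prop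
  | base => R
  | arr A B => fun f f' => ∀ x x', A.rel R x x' → B.rel R (f x) (f' x')
  | prod A B => fun x x' => A.rel R x.1 x'.1 ∧ B.rel R x.2 x'.2
  | unit => fun _ _ => True

/-- The fundamental lemma of logical relations. -/
theorem Preterm.rel_sem {Q : Type u} {Q' : Type v} (R : Q → Q' → Prop) {Γ : List Ty} {A : Ty}
    (M : Preterm Γ A) (e : Env Q Γ) (e' : Env Q' Γ) (he : ∀ A x, Ty.rel R A (e A x) (e' A x)) :
    Ty.rel R A (M.sem Q e) (M.sem Q' e') := by
  induction M with
  | var x => exact he _ x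
  | lam M ih =>
    intro b b' hb
    refine ih _ _ fun A x => ?_
    cases x with
    | zero => exact hb
    | succ x => exact he _ x
  | app M N ihM ihN => exact ihM _ _ he _ _ (ihN _ _ he)
  | pair M N ihM ihN => exact ⟨ihM _ _ he, ihN _ _ he⟩
  | fst M ih => exact (ih _ _ he).1
  | snd M ih => exact (ih _ _ he).2
  | star => trivial

theorem rel_tuple {Q : Type u} {Q' : Type v} (R : Q → Q' → Prop) {A : Ty} {n : ℕ}
    {x : Fin n → A.sem Q} {x' : Fin n → A.sem Q'} (h : ∀ i, A.rel R (x i) (x' i)) :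
    (A.pow n).rel R (tuple x) (tuple x') := by
  induction n with
  | zero => trivial
  | succ n ih => exact ⟨h 0, ih fun i => h i.succ⟩

theorem rel_proj {Q : Type u} {Q' : Type v} (R : Q → Q' → Prop) {A : Ty} {n : ℕ}
    {x : (A.pow n).sem Q} {x' : (A.pow n).sem Q'} (h : (A.pow n).rel R x x') (i : Fin n) :
    A.rel R (proj x i) (proj x' i) := by
  induction n with
  | zero => exact i.elim0
  | succ n ih =>
    induction i using Fin.cases with
    | zero => exact h.1
    | succ i => exact ih h.2 i

/-- Algebra structures are related by the graph of a map as soon as the map is a homomorphism. -/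
theorem rel_ofLetters {Q : Type u} {Q' : Type v} {S : RankedAlphabet}
    (c : ∀ j : Fin S.length, (Endo Q).carrier (S.get j))
    (c' : ∀ j : Fin S.length, (Endo Q').carrier (S.get j)) (f : Q → Q')
    (hf : ∀ j x, f (c j x) = c' j fun i => f (x i)) :
    (RankedAlphabet.ty S).rel (fun q q' => f q = q') (ofLetters c) (ofLetters c') := by
  induction S with
  | nil => trivial
  | cons n S ih =>
    refine ⟨fun x x' hx => ?_, ih _ _ fun j => hf j.succ⟩
    exact (hf 0 _).trans (congrArg (c' 0) (funext fun i => rel_proj _ hx i))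

namespace ProTm

/-- Profinite lambda-terms are parametric, since two of their components are always interpretations
of the same lambda-term. -/
theorem rel_app {A : Ty} (θ : ProTm.{u} A) {Q Q' : FinSet.{u}}
    (R : Q.carrier → Q'.carrier → Prop) : A.rel R (θ.app Q) (θ.app Q') := by
  obtain ⟨M, h, h'⟩ := θ.definable Q Q'
  obtain ⟨M, rfl⟩ := Quotient.exists_rep M
  rw [h, h']
  exact M.rel_sem R _ _ fun _ x => nomatch x

/-- Homomorphisms of finite algebras preserve the operations defined by a profinite
lambda-term. -/
theorem map_app {S : RankedAlphabet} {n : ℕ} (θ : ProTm.{u} (churchTy S n)) {Q Q' : FinSet.{u}}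
    (c : ∀ j : Fin S.length, (Endo Q.carrier).carrier (S.get j))
    (c' : ∀ j : Fin S.length, (Endo Q'.carrier).carrier (S.get j)) (f : Q.carrier → Q'.carrier)
    (hf : ∀ j x, f (c j x) = c' j fun i => f (x i)) (x : Fin n → Q.carrier) :
    f (θ.app Q (ofLetters c) (tuple (A := Ty.base) x)) =
      θ.app Q' (ofLetters c') (tuple (A := Ty.base) fun i => f (x i)) :=
  θ.rel_app (fun q q' => f q = q') _ _ (rel_ofLetters c c' f hf) _ _
    (rel_tuple (A := Ty.base) _ fun _ => rfl)

/-- The extension of a profinite lambda-term to a profinite tree. Its value at `p : F Σ → C` is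
obtained in the algebra `C_n`, on which `F Σ` acts through `p`, by evaluation at the variables. -/
def extend {S : RankedAlphabet} {n : ℕ} (θ : ProTm.{u} (churchTy S n)) :
    Completion.{u} (Free S) n where
  app C p := θ.app ⟨C.carrier n, C.finite n⟩
    (ofLetters fun j => (C.act n).toFun _ (p.toFun _ (Free.gen S j)))
    (tuple (A := Ty.base) (C.var n))
  natural C C' φ p := by
    refine (θ.map_app (Q := ⟨C.carrier n, C.finite n⟩) (Q' := ⟨C'.carrier n, C'.finite n⟩) _
      (fun j => (C'.act n).toFun _ ((φ.comp p).toFun _ (Free.gen S j))) (φ.toFun n)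
      (fun j x => φ.map_subst _ x) (C.var n)).trans ?_
    exact congrArg (fun x => θ.app ⟨C'.carrier n, C'.finite n⟩ _ (tuple (A := Ty.base) x))
      (funext (φ.map_var n))

theorem restrict_extend {S : RankedAlphabet} {n : ℕ} (θ : ProTm.{u} (churchTy S n)) :
    restrict θ.extend = θ.app := by
  funext Q σ x
  let E : FinSet.{u} := ⟨(Endo Q.carrier).carrier n, (FinEndo Q).finite n⟩
  -- Evaluation at `proj x` is a homomorphism from `End(Q)_n` to `Q`, sending the variables to `x`.
  refine (θ.map_app (Q := E) (Q' := Q) _ (letters σ)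
    (fun g => g (proj (A := Ty.base) x)) (fun _ _ => rfl) ((Endo Q.carrier).var n)).trans ?_
  rw [ofLetters_letters]
  exact congrArg (θ.app Q σ) (tuple_proj (A := Ty.base) x)

end ProTm

/-- A profinite tree is determined by its restriction: by naturality along the action
`C → End(C_n)`, its value in `C_n` is the value in `End(C_n)` evaluated at the variables. -/
theorem Completion.extend_toProTm {S : RankedAlphabet} {n : ℕ} (a : Completion.{u} (Free S) n) :
    a.toProTm.extend = a := by
  refine Completion.ext (funext fun C => funext fun p => ?_)
  let Q : FinSet.{u} := ⟨C.carrier n, C.finite n⟩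
  let c : ∀ j : Fin S.length, (Endo Q.carrier).carrier (S.get j) :=
    fun j => (C.act n).toFun _ (p.toFun _ (Free.gen S j))
  have hp : Free.lift (letters (ofLetters c)) = (C.act n).comp p := by
    rw [letters_ofLetters]
    exact (Free.existsUnique_lift c).unique (fun j => (Endo Q.carrier).subst_var (c j))
      fun _ => rfl
  refine (congrArg₂ (fun q y => a.app (FinEndo Q) q y) hp
    (proj_tuple (A := Ty.base) (C.var n))).trans ?_
  exact (congrFun (a.natural C (FinEndo Q) (C.act n) p) (C.var n)).symm.trans (C.subst_var _)

/-! ### The isomorphism -/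

/-- The restriction of profinite trees as a morphism of Stone-enriched clones. -/
def restrictHom (S : RankedAlphabet) : ProCompletion.{u, 0} (Free S) ⟶ ProChurch.{u} S :=
  StoneClone.Hom.mk
    { toFun := fun _ a => Completion.toProTm a
      map_var := fun _ _ => rfl
      map_subst := fun {m _} a _ => ProTm.ext (funext fun Q => funext fun σ => funext fun _ =>
        congrArg (Completion.app a (FinEndo Q) (Free.lift (letters σ)))
          (proj_tuple (A := Ty.base) (n := m) _).symm) }
    fun n => continuous_induced_rng.mpr <| continuous_pi fun Q =>
      -- Through `restrict`, the component at `Q` factors over finitely many discrete components.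
      (continuous_of_discreteTopology (α := (RankedAlphabet.ty S).sem Q.carrier →
          (FinEndo Q).carrier n) (β := (churchTy S n).sem Q.carrier)
        (f := fun g σ x => g σ (proj (A := Ty.base) x))).comp
      (continuous_pi fun σ => Completion.continuous_app (FinEndo Q) (Free.lift (letters σ)))

/-- A morphism of Stone-enriched clones with bijective components is an isomorphism. -/
theorem StoneClone.isIso_of_bijective {C D : StoneClone.{u}} (r : C ⟶ D)
    (h : ∀ n, Function.Bijective (StoneClone.Hom.toCloneHom r |>.toFun n)) : IsIso r := by
  let r' : StoneClone.Hom C D := r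
  let e : ∀ n, C.carrier n ≃ₜ D.carrier n := fun n =>
    (r'.continuous_toFun n).homeoOfEquivCompactToT2 (f := Equiv.ofBijective _ (h n))
  have he : ∀ n x, e n x = r'.toFun n x := fun _ _ => rfl
  let s : D ⟶ C := StoneClone.Hom.mk
    { toFun := fun n => (e n).symm
      map_var := fun n i => (e n).injective <| by
        rw [(e n).apply_symm_apply, he, r'.map_var]
      map_subst := fun {m n} x y => (e n).injective <| by
        rw [(e n).apply_symm_apply, he, r'.map_subst]
        simp only [← he, Homeomorph.apply_symm_apply] }
    fun n => (e n).symm.continuous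
  refine ⟨s, ?_, ?_⟩
  · exact StoneClone.Hom.ext (funext fun n => funext fun x => (e n).symm_apply_apply x)
  · exact StoneClone.Hom.ext (funext fun n => funext fun x => (e n).apply_symm_apply x)

end ProfiniteTree

theorem mainTheorem1 (S : ProfiniteTree.RankedAlphabet) :
    ∃ r : ProfiniteTree.ProCompletion.{u, 0} (ProfiniteTree.Free S) ⟶
        ProfiniteTree.ProChurch.{u} S,
      (∀ (n : ℕ) (a : ProfiniteTree.Completion.{u, 0} (ProfiniteTree.Free S) n),
        (r.toFun n a).app = ProfiniteTree.restrict a) ∧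
      IsIso r := by
  refine ⟨ProfiniteTree.restrictHom S, fun _ _ => rfl,
    ProfiniteTree.StoneClone.isIso_of_bijective _ fun n => ?_⟩
  exact Function.bijective_iff_has_inverse.mpr ⟨ProfiniteTree.ProTm.extend,
    ProfiniteTree.Completion.extend_toProTm,
    fun θ => ProfiniteTree.ProTm.ext θ.restrict_extend⟩
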